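/- **Theorem.** Deciding convergence $S \sqsubseteq T$ of (asynchronous) session types is undecidable. In detail, fix the message tags to be the natural numbers. *Session types* are the regular trees coinductively generated by $$S, T ::= \mathsf{end} \;\mid\; \sum_{i\in I} {?}a_i.S_i \;\mid\; \sum_{i\in I} {!}a_i.S_i$$ with $I$ finite and the tags $a_i$ $(i\in I)$ of a choice pairwise distinct, such that every subtree contains a leaf $\mathsf{end}$. Transitions $S \xrightarrow{\alpha} T$, where $\alpha$ is an input ${?}a$ or an output ${!}a$, are defined by the following rules, interpreted coinductively: - $\sum_{i\in I} {?}a_i.S_i \xrightarrow{{?}a_k} S_k$ and $\sum_{i\in I} {!}a_i.S_i \xrightarrow{{!}a_k} S_k$ for every $k \in I$; - if $S_i \xrightarrow{{?}a} T_i$ for every $i\in I$, then $\sum_{i\in I} {!}a_i.S_i \xrightarrow{{?}a} \sum_{i\in I} {!}a_i.T_i$. Transitions are deterministic; for a finite sequence $\varphi$ of actions, $S(\varphi)$ denotes the type reached from $S$ by performing $\varphi$, if there is one. Let $\mathrm{tr}(S)$ be the set of the finite sequences $\varphi$ with $S(\varphi) = \mathsf{end}$. *Convergence* $\sqsubseteq$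 is the relation inductively defined by the rule: $S \sqsubseteq T$ if for every $\varphi \in \mathrm{tr}(T)\setminus \mathrm{tr}(S)$ there are a prefix $\psi$ of $\varphi$ and a tag $a$ such that $S(\psi\,{!}a)$ and $T(\psi\,{!}a)$ are defined and $S(\psi\,{!}a) \sqsubseteq T(\psi\,{!}a)$. Let session types be represented by finite systems of equations $X_0 = e_0, \dots, X_m = e_m$ with a designated variable, where each $e_j$ is $\mathsf{end}$, $\sum_i {?}a_i.X_{q_i}$ or $\sum_i {!}a_i.X_{q_i}$ (a finite sum with pairwise distinct tags and $q_i \le m$). Then there is no algorithm (total computable function) which, given two such systems whose solutions at the designated variables are session types $S$ and $T$, correctly decides whether $S \sqsubseteq T$. Nothing is required of the function on other inputs. -/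

import Mathlib

namespace FairSession

/-- Label of a node of a session type; message tags are natural numbers. The label `inp I`
stands for an input choice `∑_{a ∈ I} ?a.S_a` and `out I` for an output choice `∑_{a ∈ I} !a.S_a`,
so the tags of a choice are pairwise distinct and there are finitely many of them. -/
inductive Shape where
  | done
  | inp (I : Finset ℕ)
  | out (I : Finset ℕ)

/-- The positions of the children of a node: one for each tag. -/
def Shape.Pos : Shape → Type
  | .done => Empty
  | .inp I => {a : ℕ // a ∈ I}
  | .out I => {a : ℕ // a ∈ I}

/-- The signature `S ::= end | ∑_{a ∈ I} ?a.S_a | ∑_{a ∈ I} !a.S_a`. -/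
def Sig : PFunctor := ⟨Shape, Shape.Pos⟩

/-- The possibly infinite trees coinductively generated by the signature (the final coalgebra). -/
def STree : Type := Sig.M

namespace STree

/-- The terminated type `end`. -/
def done : STree := PFunctor.M.mk (F := Sig) ⟨Shape.done, Empty.elim⟩

/-- The input choice `∑_{a ∈ I} ?a.(k a)`. -/
def inp (I : Finset ℕ) (k : {a : ℕ // a ∈ I} → STree) : STree :=
  PFunctor.M.mk (F := Sig) ⟨Shape.inp I, k⟩

/-- The output choice `∑_{a ∈ I} !a.(k a)`. -/
def out (I : Finset ℕ) (k : {a : ℕ // a ∈ I} → STree) : STree :=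
  PFunctor.M.mk (F := Sig) ⟨Shape.out I, k⟩

/-- `Child S T`: the tree `T` is an immediate subtree of `S`. -/
inductive Child : STree → STree → Prop
  | inp (I : Finset ℕ) (k : {a : ℕ // a ∈ I} → STree) (i : {a : ℕ // a ∈ I}) :
      Child (inp I k) (k i)
  | out (I : Finset ℕ) (k : {a : ℕ // a ∈ I} → STree) (i : {a : ℕ // a ∈ I}) :
      Child (out I k) (k i)

/-- `Subtree S T`: the tree `T` is a (not necessarily proper) subtree of `S`. -/
def Subtree : STree → STree → Prop := Relation.ReflTransGen Child

/-- Well-formedness of session types: every subtree contains a leaf `end`. In particular no choice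
in a well-formed tree is empty. -/
def WellFormed (S : STree) : Prop := ∀ T, Subtree S T → Subtree T done

/-- A session type is a well-formed tree which is regular: it has finitely many distinct
subtrees. -/
def IsSessionType (S : STree) : Prop := S.WellFormed ∧ {T | Subtree S T}.Finite

end STree

/-- Actions: `inp a` is the input `?a` and `out a` is the output `!a`. -/
inductive Act where
  | inp (a : ℕ)
  | out (a : ℕ)

open STree in
/-- The rules of the asynchronous transition relation, with premises taken from `R`. The first two
rules are the synchronous one (an enabled action of a choice is performed); by the third an input
is performed underneath an output choice, provided that all its branches can perform that input. -/
inductive StepRule (R : STree → Act → STree → Prop) : STree → Act → STree → Prop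
  | syncInp (I : Finset ℕ) (k : {a : ℕ // a ∈ I} → STree) (a : {a : ℕ // a ∈ I}) :
      StepRule R (inp I k) (Act.inp a) (k a)
  | syncOut (I : Finset ℕ) (k : {a : ℕ // a ∈ I} → STree) (a : {a : ℕ // a ∈ I}) :
      StepRule R (out I k) (Act.out a) (k a)
  | async (I : Finset ℕ) (k l : {a : ℕ // a ∈ I} → STree) (a : ℕ)
      (h : ∀ i, R (k i) (Act.inp a) (l i)) :
      StepRule R (out I k) (Act.inp a) (out I l)

/-- The asynchronous labelled transition system of session types: the rules are interpreted
coinductively, that is, `Step` is the greatest relation all of whose elements are conclusions of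
rules with premises in it. -/
def Step (S : STree) (α : Act) (T : STree) : Prop :=
  ∃ R : STree → Act → STree → Prop, (∀ S α T, R S α T → StepRule R S α T) ∧ R S α T

/-- `Steps S φ T`: the tree `S` evolves into `T` by the sequence of actions `φ`. As transitions are
deterministic, `T` is the tree written `S(φ)`. -/
inductive Steps : STree → List Act → STree → Prop
  | nil (S : STree) : Steps S [] S
  | cons {S S' T : STree} {α : Act} {φ : List Act} :
      Step S α S' → Steps S' φ T → Steps S (α :: φ) T

/-- The set `tr(S)` of the (complete) traces of `S`. -/
def traces (S : STree) : Set (List Act) := {φ | Steps S φ STree.done}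

/-- The rule defining convergence, with premises taken from `R`: for every trace `φ` of `T` that is
not a trace of `S` there are a prefix `ψ` of `φ` and a tag `a` such that `S(ψ!a)` and `T(ψ!a)` are
defined and related by `R`. -/
def ConvRule (R : STree → STree → Prop) (S T : STree) : Prop :=
  ∀ φ ∈ traces T \ traces S, ∃ (ψ : List Act) (a : ℕ) (S' T' : STree), ψ <+: φ ∧
    Steps S (ψ ++ [Act.out a]) S' ∧ Steps T (ψ ++ [Act.out a]) T' ∧ R S' T'

/-- Convergence `S ⊑ T`, inductively defined: the least relation closed under `ConvRule`. -/
def Conv (S T : STree) : Prop :=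
  ∀ R : STree → STree → Prop, (∀ S T, ConvRule R S T → R S T) → R S T

/-- The right-hand side of an equation: `none` is `end`, `some (false, [(a₁, q₁), …, (aₙ, qₙ)])` is
`?a₁.X_{q₁} + ⋯ + ?aₙ.X_{qₙ}`, and with `true` in place of `false` it is
`!a₁.X_{q₁} + ⋯ + !aₙ.X_{qₙ}`. -/
abbrev Rhs : Type := Option (Bool × List (ℕ × ℕ))

/-- Finite representation of a regular tree: `(r, [e₀, …, eₘ])` is the system of equations
`X₀ = e₀, …, Xₘ = eₘ` with designated variable `X_r`. -/
abbrev Code : Type := ℕ × List Rhs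

/-- One step of the unfolding of the variable `X_q`. -/
def Code.unfold (c : Code) (q : ℕ) : Sig ℕ :=
  match c.2[q]?.getD none with
  | none => ⟨Shape.done, Empty.elim⟩
  | some (false, l) => ⟨Shape.inp (l.map Prod.fst).toFinset, fun i => (l.lookup i.1).getD 0⟩
  | some (true, l) => ⟨Shape.out (l.map Prod.fst).toFinset, fun i => (l.lookup i.1).getD 0⟩

/-- The tree represented by a system of equations: the component of its unique solution at the
designated variable. -/
def Code.tree (c : Code) : STree := PFunctor.M.corec c.unfold c.1

/-- A system of equations that represents a session type: its variables are defined by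
the system, the tags of each choice are pairwise distinct, and the solution is a session type. -/
def Code.Valid (c : Code) : Prop :=
  c.1 < c.2.length ∧
  (∀ (b : Bool) (l : List (ℕ × ℕ)), some (b, l) ∈ c.2 →
    (l.map Prod.fst).Nodup ∧ ∀ p ∈ l, p.2 < c.2.length) ∧
  c.tree.IsSessionType

end FairSession

/-! A queue machine in state `q` with queue `a₁ … aₙ` is encoded as the type `!a₁.⋯.!aₙ.S_q`, where
`S_q` inputs a letter `a` and, if the machine goes to `q'` and appends `v`, continues with the
outputs `v` and then `S_{q'}`. Asynchrony lets an input pass below the pending outputs, so this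
response lands at the back of the queue. The supertype is the fixed echo `T`, which outputs any tag
`x` and then inputs the same `x`. Its output branches await different inputs, so `T` cannot input
early, and the encoding and `T` have only one joint run: each round outputs the head of the queue
and reads it back, which is one step of the machine.

A machine that halts emits an end marker and ignores all further input; the leftover queue drains
and both sides reach `end`. Induction on the computation then gives convergence (`conv_of_halts`).
If the machine runs forever, no jointly reachable pair has `end` on the left, although its right
component always has a trace; the complement of such an invariant is closed under the convergence
rule, so convergence fails (`not_conv_of_not_halts`).

It remains to find a queue machine with undecidable halting. A queue holding several stacks, each
behind a marker, simulates a multi-stack machine by rotation (`stackQueue_halts_iff`), and Mathlib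
compiles partial recursive functions to the multi-stack model `TM2`. The machine is fixed and only
its input varies, so the reduction merely prefixes a fixed system of equations with outputs and is
computable (`exists_reduction`). -/

namespace FairSession

/-! ### Constructors and subtrees -/

namespace STree

theorem inp_ne_done (I : Finset ℕ) (k : {a : ℕ // a ∈ I} → STree) : inp I k ≠ done := fun h => by
  have h := PFunctor.M.mk_inj (F := Sig) h
  exact Shape.noConfusion (congrArg Sigma.fst h)

theorem out_ne_done (I : Finset ℕ) (k : {a : ℕ // a ∈ I} → STree) : out I k ≠ done := fun h => by
  have h := PFunctor.M.mk_inj (F := Sig) h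
  exact Shape.noConfusion (congrArg Sigma.fst h)

theorem inp_ne_out (I J : Finset ℕ) (k : {a : ℕ // a ∈ I} → STree)
    (l : {a : ℕ // a ∈ J} → STree) : inp I k ≠ out J l := fun h => by
  have h := PFunctor.M.mk_inj (F := Sig) h
  exact Shape.noConfusion (congrArg Sigma.fst h)

theorem inp_inj {I J : Finset ℕ} {k : {a : ℕ // a ∈ I} → STree} {l : {a : ℕ // a ∈ J} → STree}
    (h : inp I k = inp J l) : I = J ∧ k ≍ l := by
  have h := PFunctor.M.mk_inj (F := Sig) h
  have h₁ : I = J := Shape.inp.inj (congrArg Sigma.fst h)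
  subst h₁
  exact ⟨rfl, (Sigma.mk.inj h).2⟩

theorem out_inj {I J : Finset ℕ} {k : {a : ℕ // a ∈ I} → STree} {l : {a : ℕ // a ∈ J} → STree}
    (h : out I k = out J l) : I = J ∧ k ≍ l := by
  have h := PFunctor.M.mk_inj (F := Sig) h
  have h₁ : I = J := Shape.out.inj (congrArg Sigma.fst h)
  subst h₁
  exact ⟨rfl, (Sigma.mk.inj h).2⟩

theorem child_iff_dest {S T : STree} :
    Child S T ↔ ∃ i : Sig.B (PFunctor.M.dest (F := Sig) S).1,
      T = (PFunctor.M.dest (F := Sig) S).2 i := by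
  constructor
  · rintro (⟨I, k, i⟩ | ⟨I, k, i⟩)
    · exact ⟨i, rfl⟩
    · exact ⟨i, rfl⟩
  · rintro ⟨i, rfl⟩
    have hS := PFunctor.M.mk_dest (F := Sig) S
    revert i hS
    generalize PFunctor.M.dest (F := Sig) S = d
    obtain ⟨_ | I | I, k⟩ := d
    · intro i
      exact Empty.elim i
    · rintro i rfl
      exact Child.inp I k i
    · rintro i rfl
      exact Child.out I k i

/-- The tree `!a.S`. -/
def emit (a : ℕ) (S : STree) : STree := out {a} fun _ => S

/-- The tree `!a₁.⋯.!aₙ.S`. -/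
def emits (w : List ℕ) (S : STree) : STree := w.foldr emit S

@[simp] theorem emits_nil (S : STree) : emits [] S = S := rfl

@[simp] theorem emits_cons (a : ℕ) (w : List ℕ) (S : STree) :
    emits (a :: w) S = emit a (emits w S) := rfl

theorem emits_append (v w : List ℕ) (S : STree) : emits (v ++ w) S = emits v (emits w S) := by
  simp [emits]

theorem emit_ne_done (a : ℕ) (S : STree) : emit a S ≠ done := out_ne_done _ _

theorem child_emit {a : ℕ} {S T : STree} : Child (emit a S) T ↔ T = S :=
  ⟨fun h => by obtain ⟨i, rfl⟩ := child_iff_dest.1 h; rfl,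
    fun h => h ▸ Child.out {a} (fun _ => S) ⟨a, Finset.mem_singleton_self a⟩⟩

theorem IsSessionType.emit {S : STree} (h : S.IsSessionType) (a : ℕ) :
    (emit a S).IsSessionType := by
  have key : ∀ T, Subtree (STree.emit a S) T → T = STree.emit a S ∨ Subtree S T := by
    intro T hT
    rcases Relation.ReflTransGen.cases_head hT with h | ⟨U, h, h'⟩
    · exact Or.inl h.symm
    · rw [child_emit] at h
      exact Or.inr (h ▸ h')
  refine ⟨fun T hT => ?_, (h.2.insert (STree.emit a S)).subset fun T hT => ?_⟩
  · rcases key T hT with rfl | hT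
    · exact Relation.ReflTransGen.head (child_emit.2 rfl) (h.1 S Relation.ReflTransGen.refl)
    · exact h.1 T hT
  · exact key T hT

end STree

/-! ### Transitions and convergence -/

open STree

theorem StepRule.mono {R R' : STree → Act → STree → Prop} (h : ∀ S α T, R S α T → R' S α T)
    {S : STree} {α : Act} {T : STree} (hS : StepRule R S α T) : StepRule R' S α T := by
  cases hS with
  | syncInp I k a => exact .syncInp I k a
  | syncOut I k a => exact .syncOut I k a
  | async I k l a hk => exact .async I k l a fun i => h _ _ _ (hk i)

theorem step_iff_stepRule {S : STree} {α : Act} {T : STree} :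
    Step S α T ↔ StepRule Step S α T := by
  have h : ∀ S α T, Step S α T → StepRule Step S α T := fun S α T ⟨R, hR, h⟩ =>
    (hR S α T h).mono fun S α T h => ⟨R, hR, h⟩
  exact ⟨h S α T, fun hS => ⟨_, fun S α T h' => h'.mono h, hS⟩⟩

theorem step_inp_iff {I : Finset ℕ} {k : {a : ℕ // a ∈ I} → STree} {α : Act} {T : STree} :
    Step (inp I k) α T ↔ ∃ a : {a : ℕ // a ∈ I}, α = Act.inp a ∧ T = k a := by
  rw [step_iff_stepRule]
  constructor
  · intro h
    generalize hS : inp I k = S at h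
    cases h with
    | syncInp J l a =>
      obtain ⟨rfl, hk⟩ := inp_inj hS
      cases hk
      exact ⟨a, rfl, rfl⟩
    | syncOut J l a => exact absurd hS (inp_ne_out _ _ _ _)
    | async J k l a hk => exact absurd hS (inp_ne_out _ _ _ _)
  · rintro ⟨a, rfl, rfl⟩
    exact .syncInp I k a

theorem step_out_out_iff {I : Finset ℕ} {k : {a : ℕ // a ∈ I} → STree} {a : ℕ} {T : STree} :
    Step (out I k) (Act.out a) T ↔ ∃ h : a ∈ I, T = k ⟨a, h⟩ := by
  rw [step_iff_stepRule]
  constructor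
  · intro h
    generalize hS : out I k = S, hα : Act.out a = α at h
    cases h with
    | syncInp J l a => cases hα
    | syncOut J l b =>
      obtain ⟨rfl, hk⟩ := out_inj hS
      cases hk
      cases hα
      exact ⟨b.2, rfl⟩
    | async J k l a hk => cases hα
  · rintro ⟨h, rfl⟩
    exact .syncOut I k ⟨a, h⟩

theorem step_out_inp_iff {I : Finset ℕ} {k : {a : ℕ // a ∈ I} → STree} {a : ℕ} {T : STree} :
    Step (out I k) (Act.inp a) T ↔
      ∃ l : {a : ℕ // a ∈ I} → STree, T = out I l ∧ ∀ i, Step (k i) (Act.inp a) (l i) := by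
  rw [step_iff_stepRule]
  constructor
  · intro h
    generalize hS : out I k = S, hα : Act.inp a = α at h
    cases h with
    | syncInp J l a => exact absurd hS.symm (inp_ne_out _ _ _ _)
    | syncOut J l b => cases hα
    | async J k l a hk =>
      obtain ⟨rfl, hk⟩ := out_inj hS
      cases hk
      cases hα
      exact ⟨l, rfl, hk⟩
  · rintro ⟨l, rfl, h⟩
    exact .async I k l a h

theorem step_emit_out_iff {a b : ℕ} {S T : STree} :
    Step (emit a S) (Act.out b) T ↔ b = a ∧ T = S := by
  simp [emit, step_out_out_iff]

theorem step_emit_inp_iff {a b : ℕ} {S T : STree} :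
    Step (emit a S) (Act.inp b) T ↔ ∃ S', Step S (Act.inp b) S' ∧ T = emit a S' := by
  rw [emit, step_out_inp_iff]
  constructor
  · rintro ⟨l, rfl, h⟩
    refine ⟨_, h ⟨a, Finset.mem_singleton_self a⟩, congrArg _ (funext fun i => ?_)⟩
    congr 1
    exact Subtype.ext (Finset.mem_singleton.1 i.2)
  · rintro ⟨S', h, rfl⟩
    exact ⟨_, rfl, fun _ => h⟩

/-- The queue discipline: whatever `S` emits in response to the input comes behind the pending word
`w`. -/
theorem step_emits_inp_iff {w : List ℕ} {b : ℕ} {S T : STree} :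
    Step (emits w S) (Act.inp b) T ↔ ∃ S', Step S (Act.inp b) S' ∧ T = emits w S' := by
  induction w generalizing T with
  | nil => simp
  | cons a w ih =>
    simp only [emits_cons, step_emit_inp_iff, ih]
    constructor
    · rintro ⟨_, ⟨S', h, rfl⟩, rfl⟩
      exact ⟨S', h, rfl⟩
    · rintro ⟨S', h, rfl⟩
      exact ⟨_, ⟨S', h, rfl⟩, rfl⟩

theorem Steps.invariant {P : STree → STree → Prop}
    (hP : ∀ S T α S' T', P S T → Step S α S' → Step T α T' → P S' T')
    {S T S' T' : STree} {φ : List Act} (h : P S T) (hS : Steps S φ S') (hT : Steps T φ T') :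
    P S' T' := by
  induction hS generalizing T with
  | nil S => cases hT; exact h
  | cons hs _ ih =>
    cases hT with
    | cons ht hT => exact ih (hP _ _ _ _ _ h hs ht) hT

theorem Conv.intro {S T : STree} (h : ConvRule Conv S T) : Conv S T := fun R hR =>
  hR S T fun φ hφ =>
    let ⟨ψ, a, S', T', hψ, hS, hT, hc⟩ := h φ hφ
    ⟨ψ, a, S', T', hψ, hS, hT, hc R hR⟩

/-- If all pairs reached from a pair of trees by common traces consist of a first component other
than `end` and of a second component with a trace, then there is no convergence. -/
theorem not_conv_of_invariant {P : STree → STree → Prop}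
    (hP : ∀ S T α S' T', P S T → Step S α S' → Step T α T' → P S' T')
    (hdone : ∀ T, ¬ P done T) (htr : ∀ S T, P S T → (traces T).Nonempty)
    {S T : STree} (h : P S T) : ¬ Conv S T := by
  intro hc
  -- Convergence is the least relation closed under the rule, so closure of the complement of `P`
  -- suffices.
  refine hc (fun S T => ¬ P S T) (fun S T hST h => ?_) h
  obtain ⟨φ, hφ⟩ := htr S T h
  obtain ⟨ψ, a, S', T', -, hS, hT, hn⟩ := hST φ ⟨hφ, fun hS =>
    hdone _ (Steps.invariant hP h hS hφ)⟩
  exact hn (Steps.invariant hP h hS hT)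

theorem conv_of_traces_subset {S T : STree} (h : traces T ⊆ traces S) : Conv S T :=
  Conv.intro fun _ hφ => absurd (h hφ.1) hφ.2

theorem conv_of_step_out {S S' T T' : STree} {a : ℕ} (hS : Step S (Act.out a) S')
    (hT : Step T (Act.out a) T') (h : Conv S' T') : Conv S T :=
  Conv.intro fun φ _ => ⟨[], a, S', T', φ.nil_prefix, .cons hS (.nil _), .cons hT (.nil _), h⟩

/-- Inversion: `ConvRule Conv` is itself closed under the rule, hence contains the least such
relation. -/
theorem Conv.convRule {S T : STree} (h : Conv S T) : ConvRule Conv S T :=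
  h (ConvRule Conv) fun _ _ hST φ hφ =>
    let ⟨ψ, a, S', T', hψ, hS, hT, hc⟩ := hST φ hφ
    ⟨ψ, a, S', T', hψ, hS, hT, Conv.intro hc⟩

/-- Every trace on the right starts with `?b`, which `S` can match, so the witnesses for `S'` serve
again with `?b` put in front of `ψ`. -/
theorem conv_of_step_inp {S S' T : STree} {b : ℕ} (hS : Step S (Act.inp b) S') (h : Conv S' T) :
    Conv S (inp {b} fun _ => T) := by
  have hT : Step (inp {b} fun _ => T) (Act.inp b) T :=
    step_inp_iff.2 ⟨⟨b, Finset.mem_singleton_self b⟩, rfl, rfl⟩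
  refine Conv.intro fun φ ⟨h₁, h₂⟩ => ?_
  rw [traces, Set.mem_ofPred_eq] at h₁ h₂
  generalize hV : (inp {b} fun _ => T) = V at h₁
  cases φ with
  | nil =>
    cases h₁
    exact absurd hV (inp_ne_done _ _)
  | cons α φ =>
    cases h₁ with
    | cons hs hss =>
      subst hV
      obtain ⟨c, rfl, rfl⟩ := step_inp_iff.1 hs
      rw [Finset.mem_singleton.1 c.2] at h₂ ⊢
      obtain ⟨ψ, a, S'', T'', hψ, hS', hT', hc⟩ :=
        h.convRule φ ⟨hss, fun hs => h₂ (.cons hS hs)⟩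
      exact ⟨Act.inp b :: ψ, a, S'', T'', List.cons_prefix_cons.2 ⟨rfl, hψ⟩, .cons hS hS',
        .cons hT hT', hc⟩

/-! ### Finite coalgebras as systems of equations -/

/-- The tree unfolded from a state of a coalgebra of the signature. -/
def STree.corec {X : Type} (g : X → Sig X) (x : X) : STree := PFunctor.M.corec g x

/-- Uniqueness of maps into the final coalgebra, with `h` required to be a morphism only on a part
`p` closed under successors. -/
theorem corec_eq_of_hom {X Y : Type} {g : X → Sig X} {g' : Y → Sig Y} {h : X → Y} {p : X → Prop}
    (hp : ∀ x, p x → ∀ i, p ((g x).2 i)) (hg : ∀ x, p x → g' (h x) = Sig.map h (g x))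
    {x : X} (hx : p x) :
    corec g' (h x) = corec g x := by
  refine PFunctor.M.bisim' p (fun x => PFunctor.M.corec g' (h x)) (PFunctor.M.corec g) ?_ x hx
  intro x hx
  refine ⟨(g x).1, fun i => PFunctor.M.corec g' (h ((g x).2 i)),
    fun i => PFunctor.M.corec g ((g x).2 i), ?_, ?_, fun i => ⟨_, hp x hx i, rfl, rfl⟩⟩
  · rw [PFunctor.M.dest_corec, hg x hx]
    rfl
  · rw [PFunctor.M.dest_corec]
    rfl

theorem child_corec {X : Type} {g : X → Sig X} {x : X} {T : STree} :
    Child (corec g x) T ↔ ∃ i, T = corec g ((g x).2 i) := by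
  rw [child_iff_dest, STree.corec, PFunctor.M.dest_corec]
  rfl

theorem isSessionType_corec {X : Type} {g : X → Sig X} {s : Set X} (hs : s.Finite)
    (hg : ∀ x ∈ s, ∀ i, (g x).2 i ∈ s)
    (hd : ∀ x ∈ s, Subtree (corec g x) done) {x : X} (hx : x ∈ s) :
    (corec g x).IsSessionType := by
  have key : ∀ T, Subtree (corec g x) T → ∃ y ∈ s, T = corec g y := by
    intro T hT
    induction hT with
    | refl => exact ⟨x, hx, rfl⟩
    | tail _ hT ih =>
      obtain ⟨y, hy, rfl⟩ := ih
      obtain ⟨i, rfl⟩ := child_corec.1 hT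
      exact ⟨_, hg y hy i, rfl⟩
  refine ⟨fun T hT => ?_, (hs.image (corec g)).subset fun T hT => ?_⟩
  · obtain ⟨y, hy, rfl⟩ := key T hT
    exact hd y hy
  · obtain ⟨y, hy, rfl⟩ := key T hT
    exact ⟨y, hy, rfl⟩

/-- All variables of the right-hand side are less than `m`, and its tags are distinct. -/
def Rhs.WF (m : ℕ) (e : Rhs) : Prop :=
  ∀ b l, e = some (b, l) → (l.map Prod.fst).Nodup ∧ ∀ p ∈ l, p.2 < m

theorem Code.valid_iff {c : Code} :
    c.Valid ↔ c.1 < c.2.length ∧ (∀ e ∈ c.2, Rhs.WF c.2.length e) ∧ c.tree.IsSessionType := by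
  refine and_congr Iff.rfl (and_congr ⟨fun h e he b l hl => h b l (hl ▸ he), fun h b l hl =>
    h _ hl b l rfl⟩ Iff.rfl)

theorem lookup_map_mk {α β γ : Type*} [BEq β] [LawfulBEq β] {e : α → β}
    (he : Function.Injective e) (f : α → γ) {l : List α} {a : α} (ha : a ∈ l) :
    (l.map fun a => (e a, f a)).lookup (e a) = some (f a) := by
  induction l with
  | nil => simp at ha
  | cons b l ih =>
    by_cases hab : a = b
    · subst hab
      simp
    · rw [List.map_cons, List.lookup_cons, beq_false_of_ne (he.ne hab)]
      exact ih ((List.mem_cons.1 ha).resolve_left hab)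

/-- The equation for a node of a coalgebra whose states are numbered by `f`. -/
noncomputable def Rhs.ofSig {X : Type} (f : X → ℕ) : Sig X → Rhs
  | ⟨.done, _⟩ => none
  | ⟨.inp I, k⟩ => some (false, I.attach.toList.map fun i => (i.1, f (k i)))
  | ⟨.out I, k⟩ => some (true, I.attach.toList.map fun i => (i.1, f (k i)))

theorem Rhs.wf_ofSig {X : Type} {f : X → ℕ} {m : ℕ} {d : Sig X} (h : ∀ i, f (d.2 i) < m) :
    (Rhs.ofSig f d).WF m := by
  have key : ∀ (I : Finset ℕ) (k : {a : ℕ // a ∈ I} → X), (∀ i, f (k i) < m) →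
      ((I.attach.toList.map fun i => (i.1, f (k i))).map Prod.fst).Nodup ∧
        ∀ p ∈ I.attach.toList.map fun i => (i.1, f (k i)), p.2 < m := by
    intro I k hk
    constructor
    · rw [List.map_map]
      exact (Finset.nodup_toList _).map Subtype.val_injective
    · intro p hp
      obtain ⟨i, -, rfl⟩ := List.mem_map.1 hp
      exact hk i
  obtain ⟨_ | I | I, k⟩ := d
  · intro b l hl
    cases hl
  · intro b l hl
    cases hl
    exact key I k h
  · intro b l hl
    cases hl
    exact key I k h

theorem Code.unfold_eq_map {X : Type} {f : X → ℕ} {c : Code} {q : ℕ} {d : Sig X}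
    (h : c.2[q]? = some (Rhs.ofSig f d)) : c.unfold q = Sig.map f d := by
  -- The tag set of the list equals `I` only propositionally; `I` is eliminated before the children,
  -- whose type depends on it, are compared.
  have key : ∀ (I : Finset ℕ) (k : {a : ℕ // a ∈ I} → X) (l : List (ℕ × ℕ)),
      l = (I.attach.toList.map fun i => (i.1, f (k i))) → ∃ h : (l.map Prod.fst).toFinset = I,
        ∀ i : {a : ℕ // a ∈ I}, (l.lookup i.1).getD 0 = f (k i) := by
    rintro I k l rfl
    refine ⟨?_, fun i => ?_⟩
    · ext a
      simp
    · rw [lookup_map_mk Subtype.val_injective (fun i => f (k i)) (by simp)]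
      rfl
  unfold Code.unfold
  rw [h]
  obtain ⟨_ | I | I, k⟩ := d
  · exact congrArg (Sigma.mk _) (funext fun i => i.elim)
  · generalize hl : (I.attach.toList.map fun i => (i.1, f (k i))) = l
    obtain ⟨rfl, h⟩ := key I k l hl.symm
    simp only [Rhs.ofSig, hl, Option.getD_some]
    exact congrArg (Sigma.mk _) (funext h)
  · generalize hl : (I.attach.toList.map fun i => (i.1, f (k i))) = l
    obtain ⟨rfl, h⟩ := key I k l hl.symm
    simp only [Rhs.ofSig, hl, Option.getD_some]
    exact congrArg (Sigma.mk _) (funext h)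

/-- A state of a coalgebra from which finitely many states are reachable and all of them reach a
leaf is represented by a system of equations. -/
theorem exists_code {X : Type} {g : X → Sig X} {s : Set X} (hs : s.Finite)
    (hg : ∀ x ∈ s, ∀ i, (g x).2 i ∈ s)
    (hd : ∀ x ∈ s, Subtree (corec g x) done) {x : X} (hx : x ∈ s) :
    ∃ c : Code, c.Valid ∧ c.tree = corec g x := by
  classical
  let L := hs.toFinset.toList
  have hL : ∀ y, y ∈ L ↔ y ∈ s := fun y => by simp [L]
  let f : X → ℕ := fun y => L.idxOf y
  have hf : ∀ y ∈ s, f y < L.length := fun y hy => List.idxOf_lt_length_iff.2 ((hL y).2 hy)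
  let c : Code := (f x, L.map fun y => Rhs.ofSig f (g y))
  have hc : c.2.length = L.length := List.length_map _
  have htree : c.tree = corec g x := by
    refine corec_eq_of_hom (p := (· ∈ s)) (h := f) hg (fun y hy => Code.unfold_eq_map ?_) hx
    rw [List.getElem?_map, List.getElem?_idxOf ((hL y).2 hy)]
    rfl
  refine ⟨c, Code.valid_iff.2 ⟨hc ▸ hf x hx, ?_, ?_⟩, htree⟩
  · intro e he
    obtain ⟨y, hy, rfl⟩ := List.mem_map.1 he
    exact hc ▸ Rhs.wf_ofSig fun i => hf _ (hg y ((hL y).1 hy) i)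
  · rw [htree]
    exact isSessionType_corec hs hg hd hx

/-- The system that represents `!a.S`, if `c` represents `S`. -/
def Code.emit (a : ℕ) (c : Code) : Code := (c.2.length, c.2 ++ [some (true, [(a, c.1)])])

theorem Code.unfold_lt {c : Code} (hc : ∀ e ∈ c.2, Rhs.WF c.2.length e) {q : ℕ}
    (hq : q < c.2.length) (i : Sig.B (c.unfold q).1) : (c.unfold q).2 i < c.2.length := by
  have key : ∀ l : List (ℕ × ℕ), ∀ a : ℕ, (∀ p ∈ l, p.2 < c.2.length) →
      (l.lookup a).getD 0 < c.2.length := by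
    intro l a hl
    rcases h : l.lookup a with _ | p
    -- The default `0` of `getD` is also a variable of the system, since the system is nonempty.
    · exact (Nat.zero_le q).trans_lt hq
    · obtain ⟨l₁, l₂, rfl, -⟩ := List.lookup_eq_some_iff.1 h
      exact hl (a, p) (by simp)
  have hq' := List.getElem?_eq_getElem hq
  have hmem := hc _ (List.getElem_mem hq)
  revert i
  unfold Code.unfold
  rw [hq']
  revert hmem
  generalize c.2[q] = e
  intro hmem
  obtain _ | ⟨_ | _, l⟩ := e
  · intro i
    exact Empty.elim i
  · intro i
    exact key l _ (hmem _ _ rfl).2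
  · intro i
    exact key l _ (hmem _ _ rfl).2

/-- By validity the old equations mention only old variables, so appending an equation does not
change their solution. -/
theorem Code.tree_emit (a : ℕ) {c : Code} (hc : c.Valid) : (c.emit a).tree = STree.emit a c.tree := by
  rw [Code.valid_iff] at hc
  have key : corec (c.emit a).unfold c.1 = c.tree := by
    refine corec_eq_of_hom (h := id) (p := (· < c.2.length)) (g := c.unfold)
      (fun q hq => Code.unfold_lt hc.2.1 hq) (fun q hq => ?_) hc.1
    have : (c.emit a).unfold q = c.unfold q := by
      unfold Code.unfold Code.emit
      rw [List.getElem?_append_left hq]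
    rw [id, this]
    rfl
  have hunf : (c.emit a).unfold c.2.length = ⟨Shape.out {a}, fun _ => c.1⟩ := by
    have h : (c.emit a).2[c.2.length]? = some (Rhs.ofSig id ⟨Shape.out {a}, fun _ => c.1⟩) := by
      have ha : ({a} : Finset ℕ).attach = {⟨a, Finset.mem_singleton_self a⟩} :=
        Finset.ext fun i => by
          simpa [Subtype.ext_iff] using Finset.mem_singleton.1 i.2
      simp only [Code.emit, Rhs.ofSig, ha, Finset.toList_singleton]
      exact List.getElem?_concat_length
    exact Code.unfold_eq_map h
  unfold Code.tree
  rw [PFunctor.M.corec_def]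
  change PFunctor.M.mk (Sig.map _ ((c.emit a).unfold c.2.length)) = _
  rw [hunf]
  exact congrArg (fun S => STree.emit a S) key

theorem Code.Valid.emit {c : Code} (hc : c.Valid) (a : ℕ) : (c.emit a).Valid := by
  have ht := Code.tree_emit a hc
  rw [Code.valid_iff] at hc ⊢
  have hlen : (c.emit a).2.length = c.2.length + 1 := by simp [Code.emit]
  refine ⟨by rw [hlen]; exact Nat.lt_succ_self _, ?_, ht ▸ hc.2.2.emit a⟩
  rw [hlen]
  intro e he
  rcases List.mem_append.1 he with he | he
  · intro b l hl
    exact ⟨(hc.2.1 e he b l hl).1, fun p hp => ((hc.2.1 e he b l hl).2 p hp).trans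
      (Nat.lt_succ_self _)⟩
  · rw [List.mem_singleton.1 he]
    intro b l hl
    cases hl
    simpa using hc.1.trans (Nat.lt_succ_self _)

open StateTransition

/-! ### Queue machines as session types -/

section QueueMachine

variable {Q A : Type}

/-- A step of the queue machine with transition function `δ`: in state `q`, the first symbol `a`
of the queue is removed and, if `δ q a = (q', v)`, the word `v` is appended to the queue. The
machine halts if `δ q a` is undefined, and it loops on the empty queue. -/
def queueStep (δ : Q → A → Option (Q × List A)) : Q × List A → Option (Q × List A)
  | (q, []) => some (q, [])
  | (q, a :: w) => (δ q a).map fun p => (p.1, w ++ p.2)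

variable [Encodable A] (δ : Q → A → Option (Q × List A)) (n : ℕ)

/-- The word emitted and the state entered by a queue machine which reads the tag `x`; the end
marker `n` terminates, and a machine that halts emits the end marker and then ignores its input. -/
def queueReact (q : Option Q) (x : ℕ) : Option (List ℕ × Option Q) :=
  if x = n then none else
    match q with
    | none => some ([], none)
    | some q =>
      match Encodable.decode (α := A) x with
      | none => none
      | some a =>
        match δ q a with
        | none => some ([n], none)
        | some (q', v) => some (v.map Encodable.encode, some q')

/-- The coalgebra that unfolds to the session type of a queue machine. Its states are the final
state `none` and the pairs of a word to be emitted and of a state of the machine. -/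
def queueNode : Option (List ℕ × Option Q) → Sig (Option (List ℕ × Option Q))
  | none => ⟨Shape.done, Empty.elim⟩
  | some (a :: w, q) => ⟨Shape.out {a}, fun _ => some (w, q)⟩
  | some ([], q) => ⟨Shape.inp (Finset.range (n + 1)), fun x => queueReact δ n q x.1⟩

/-- The session type of a queue machine with an empty queue. -/
def queueTree (q : Option Q) : STree := corec (queueNode δ n) (some ([], q))

theorem corec_queueNode_none : corec (queueNode δ n) none = done :=
  (PFunctor.M.corec_def _ _).trans <|
    congrArg (fun f => PFunctor.M.mk (F := Sig) ⟨Shape.done, f⟩) (funext fun i => i.elim)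

theorem corec_queueNode_some (w : List ℕ) (q : Option Q) :
    corec (queueNode δ n) (some (w, q)) = emits w (queueTree δ n q) := by
  induction w with
  | nil => rfl
  | cons a w ih =>
    rw [emits_cons, ← ih]
    exact PFunctor.M.corec_def _ _

theorem queueTree_eq (q : Option Q) : queueTree δ n q =
    inp (Finset.range (n + 1)) fun x => corec (queueNode δ n) (queueReact δ n q x.1) :=
  PFunctor.M.corec_def _ _

theorem step_queueTree_iff {q : Option Q} {x : ℕ} {T : STree} :
    Step (queueTree δ n q) (Act.inp x) T ↔
      x ≤ n ∧ T = corec (queueNode δ n) (queueReact δ n q x) := by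
  rw [queueTree_eq, step_inp_iff]
  constructor
  · rintro ⟨⟨a, ha⟩, hx, rfl⟩
    cases hx
    exact ⟨Nat.lt_succ_iff.1 (Finset.mem_range.1 ha), rfl⟩
  · rintro ⟨hx, rfl⟩
    exact ⟨⟨x, Finset.mem_range.2 (Nat.lt_succ_iff.2 hx)⟩, rfl, rfl⟩

theorem not_step_queueTree_out {q : Option Q} {x : ℕ} {T : STree} :
    ¬ Step (queueTree δ n q) (Act.out x) T := by
  rw [queueTree_eq, step_inp_iff]
  rintro ⟨a, h, -⟩
  cases h

theorem exists_code_queueTree (hA : ∀ a : A, Encodable.encode a < n) {s : Set Q} (hs : s.Finite)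
    {L : ℕ} (hδ : ∀ q ∈ s, ∀ a q' v, δ q a = some (q', v) → q' ∈ s ∧ v.length ≤ L)
    {q : Q} (hq : q ∈ s) : ∃ c : Code, c.Valid ∧ c.tree = queueTree δ n (some q) := by
  -- The bound is `L + 1` rather than `L` to cover the word `[n]` emitted on halting.
  have hfin : {w : List ℕ | w.length ≤ L + 1 ∧ ∀ x ∈ w, x ≤ n}.Finite := by
    refine ((List.finite_length_le (Fin (n + 1)) (L + 1)).image (List.map Fin.val)).subset ?_
    rintro w ⟨hw, hx⟩
    refine ⟨w.pmap (fun x hx => ⟨x, Nat.lt_succ_iff.2 hx⟩) hx, by simpa using hw, ?_⟩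
    rw [List.map_pmap]
    simp
  let X : Set (Option (List ℕ × Option Q)) := insert none
    (some '' ({w : List ℕ | w.length ≤ L + 1 ∧ ∀ x ∈ w, x ≤ n} ×ˢ insert none (some '' s)))
  have hX : X.Finite := ((hfin.prod ((hs.image _).insert _)).image _).insert _
  have hmem : ∀ w q, some (w, q) ∈ X ↔
      (w.length ≤ L + 1 ∧ ∀ x ∈ w, x ≤ n) ∧ (q = none ∨ ∃ p ∈ s, some p = q) := by
    intro w q
    simp [X]
  refine exists_code (g := queueNode δ n) (s := X) hX ?_ ?_
    ((hmem _ _).2 ⟨⟨by simp, by simp⟩, Or.inr ⟨q, hq, rfl⟩⟩)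
  · rintro (_ | ⟨_ | ⟨a, w⟩, q⟩) hx i
    · exact i.elim
    · change queueReact δ n q i.1 ∈ X
      rw [hmem] at hx
      unfold queueReact
      split_ifs with hi
      · exact Set.mem_insert _ _
      rcases hx.2 with rfl | ⟨p, hp, rfl⟩
      · exact (hmem _ _).2 ⟨⟨by simp, by simp⟩, Or.inl rfl⟩
      · dsimp only
        rcases Encodable.decode (α := A) i.1 with _ | a
        · exact Set.mem_insert _ _
        · dsimp only
          rcases h : δ p a with _ | ⟨q', v⟩
          · exact (hmem _ _).2 ⟨⟨by simp, by simp⟩, Or.inl rfl⟩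
          · obtain ⟨hq', hv⟩ := hδ p hp a q' v h
            refine (hmem _ _).2 ⟨⟨by simpa using Nat.le_succ_of_le hv, fun x hx => ?_⟩,
              Or.inr ⟨q', hq', rfl⟩⟩
            obtain ⟨b, -, rfl⟩ := List.mem_map.1 hx
            exact (hA b).le
    · rw [hmem] at hx
      exact (hmem _ _).2 ⟨⟨(Nat.le_succ _).trans hx.1.1,
        fun x hxw => hx.1.2 x (List.mem_cons_of_mem _ hxw)⟩, hx.2⟩
  -- A leaf is reached by performing the pending outputs and then reading the end marker.
  · rintro (_ | ⟨w, q⟩) -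
    · rw [corec_queueNode_none]
      exact Relation.ReflTransGen.refl
    · rw [corec_queueNode_some]
      induction w with
      | nil =>
        refine Relation.ReflTransGen.single ?_
        rw [emits_nil, queueTree_eq]
        have h := Child.inp (Finset.range (n + 1))
          (fun x => corec (queueNode δ n) (queueReact δ n q x.1)) ⟨n, by simp⟩
        have h₁ : queueReact δ n q n = none := if_pos rfl
        dsimp only at h
        rwa [h₁, corec_queueNode_none] at h
      | cons a w ih => exact Relation.ReflTransGen.head (child_emit.2 rfl) ih

/-! ### The echo type, and convergence as halting -/

/-- The coalgebra that unfolds to the session type which echoes every tag and stops after the end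
marker `n`. -/
def echoNode : Option (Option ℕ) → Sig (Option (Option ℕ))
  | none => ⟨Shape.done, Empty.elim⟩
  | some none => ⟨Shape.out (Finset.range (n + 1)), fun x => some (some x.1)⟩
  | some (some x) => ⟨Shape.inp {x}, fun _ => if x = n then none else some none⟩

/-- The session type `T = ∑_{x < n} !x.?x.T + !n.?n.end`. -/
def echoTree : STree := corec (echoNode n) (some none)

theorem corec_echoNode_none : corec (echoNode n) none = done :=
  (PFunctor.M.corec_def _ _).trans <|
    congrArg (fun f => PFunctor.M.mk (F := Sig) ⟨Shape.done, f⟩) (funext fun i => i.elim)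

/-- The session type `?x.T`, where `T` echoes, or `?n.end` if `x = n`. -/
def echoInp (x : ℕ) : STree := inp {x} fun _ => if x = n then done else echoTree n

theorem corec_echoNode_some_some (x : ℕ) : corec (echoNode n) (some (some x)) = echoInp n x := by
  refine (PFunctor.M.corec_def _ _).trans ?_
  refine congrArg (fun S => inp {x} fun _ => S) ?_
  change corec (echoNode n) (if x = n then none else some none) = _
  split_ifs
  · exact corec_echoNode_none n
  · rfl

theorem echoTree_eq : echoTree n = out (Finset.range (n + 1)) fun x => echoInp n x.1 :=
  (PFunctor.M.corec_def _ _).trans <|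
    congrArg (out _) (funext fun x => corec_echoNode_some_some n x.1)

theorem step_echoTree_out {x : ℕ} {T : STree} :
    Step (echoTree n) (Act.out x) T ↔ x ≤ n ∧ T = echoInp n x := by
  rw [echoTree_eq, step_out_out_iff]
  simp

theorem step_echoInp_iff {x : ℕ} {α : Act} {T : STree} :
    Step (echoInp n x) α T ↔ α = Act.inp x ∧ T = if x = n then done else echoTree n := by
  simp [echoInp, step_inp_iff]

/-- An asynchronous input must be possible in all branches, but those of `0` and `n` await different
tags. -/
theorem not_step_echoTree_inp (hn : 0 < n) {x : ℕ} {T : STree} :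
    ¬ Step (echoTree n) (Act.inp x) T := by
  rw [echoTree_eq, step_out_inp_iff]
  rintro ⟨l, -, h⟩
  have h₀ := ((step_echoInp_iff n).1 (h ⟨0, by simp⟩)).1
  have h₁ := ((step_echoInp_iff n).1 (h ⟨n, by simp⟩)).1
  rw [h₀, Act.inp.injEq] at h₁
  exact hn.ne h₁

theorem exists_code_echoTree : ∃ c : Code, c.Valid ∧ c.tree = echoTree n := by
  have hn : Subtree (echoInp n n) done := by
    refine Relation.ReflTransGen.single ?_
    have h : Child (echoInp n n) (if n = n then done else echoTree n) :=
      Child.inp {n} (fun _ => if n = n then done else echoTree n) ⟨n, by simp⟩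
    rwa [if_pos rfl] at h
  have h₀ : Subtree (echoTree n) done := by
    refine Relation.ReflTransGen.head ?_ hn
    rw [echoTree_eq]
    exact Child.out _ (fun x => echoInp n x.1) ⟨n, by simp⟩
  refine exists_code (g := echoNode n)
    (s := insert none (some '' insert none (some '' Set.Iic n)))
    ((((Set.finite_Iic n).image _).insert _).image _ |>.insert _) ?_ ?_ (by simp)
  · rintro (_ | _ | x) hx i
    · exact i.elim
    · have hi : i.1 ≤ n := Nat.lt_succ_iff.1 (Finset.mem_range.1 i.2)
      change some (some i.1) ∈ _
      simpa using hi
    · change (if x = n then none else some none) ∈ _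
      split_ifs <;> simp
  · rintro (_ | _ | x) hx
    · rw [corec_echoNode_none]
      exact Relation.ReflTransGen.refl
    · exact h₀
    · rw [corec_echoNode_some_some]
      by_cases h : x = n
      · exact h ▸ hn
      · refine Relation.ReflTransGen.head ?_ h₀
        have h₁ : Child (echoInp n x) (if x = n then done else echoTree n) :=
          Child.inp {x} (fun _ => if x = n then done else echoTree n) ⟨x, by simp⟩
        rwa [if_neg h] at h₁

theorem traces_echoInp_end : [Act.inp n] ∈ traces (echoInp n n) :=
  .cons ((step_echoInp_iff n).2 ⟨rfl, (if_pos rfl).symm⟩) (.nil _)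

theorem traces_echoTree_end : [Act.out n, Act.inp n] ∈ traces (echoTree n) :=
  .cons ((step_echoTree_out n).2 ⟨le_rfl, rfl⟩) (traces_echoInp_end n)

/-- One round: `x` is output by both sides and then read back, on the left possibly below pending
outputs. -/
theorem conv_echoTree {S S' : STree} {x : ℕ} (hx : x < n) (hS : Step S (Act.inp x) S')
    (h : Conv S' (echoTree n)) : Conv (emit x S) (echoTree n) := by
  refine conv_of_step_out (step_emit_out_iff.2 ⟨rfl, rfl⟩)
    ((step_echoTree_out n).2 ⟨hx.le, rfl⟩) ?_
  unfold echoInp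
  rw [if_neg hx.ne]
  exact conv_of_step_inp hS h

/-- After halting, the leftover letters are echoed and ignored until reading back `n` ends both
sides. -/
theorem conv_drain {w : List ℕ} (hw : ∀ x ∈ w, x < n) :
    Conv (emits (w ++ [n]) (queueTree δ n none)) (echoTree n) := by
  induction w with
  | nil =>
    refine conv_of_step_out (step_emit_out_iff.2 ⟨rfl, rfl⟩)
      ((step_echoTree_out n).2 ⟨le_rfl, rfl⟩) ?_
    unfold echoInp
    rw [if_pos rfl]
    refine conv_of_step_inp (S' := done) ((step_queueTree_iff δ n).2 ⟨le_rfl, ?_⟩)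
      (conv_of_traces_subset subset_rfl)
    rw [queueReact, if_pos rfl, corec_queueNode_none]
  | cons x w ih =>
    have hx := hw x List.mem_cons_self
    refine conv_echoTree n hx (step_emits_inp_iff.2 ⟨_, (step_queueTree_iff δ n).2 ⟨hx.le, rfl⟩,
      rfl⟩) ?_
    rw [queueReact, if_neg hx.ne]
    exact ih fun y hy => hw y (List.mem_cons_of_mem _ hy)

variable {n}

theorem queueReact_encode (hA : ∀ a : A, Encodable.encode a < n) (q : Q) (a : A) :
    queueReact δ n (some q) (Encodable.encode a) =
      match δ q a with
      | none => some ([n], none)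
      | some (q', v) => some (v.map Encodable.encode, some q') := by
  rw [queueReact, if_neg (hA a).ne]
  simp only [Encodable.encodek]

theorem conv_of_halts (hA : ∀ a : A, Encodable.encode a < n) {c : Q × List A}
    (h : (eval (queueStep δ) c).Dom) :
    Conv (emits (c.2.map Encodable.encode) (queueTree δ n (some c.1))) (echoTree n) := by
  obtain ⟨b, hb⟩ := Part.dom_iff_mem.1 h
  refine evalInduction hb fun c _ ih => ?_
  obtain ⟨q, _ | ⟨a, w⟩⟩ := c
  -- The empty queue steps to itself, so the induction hypothesis is the claim.
  · exact ih (q, []) rfl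
  · refine conv_echoTree n (hA a) (step_emits_inp_iff.2 ⟨_, (step_queueTree_iff δ n).2
      ⟨(hA a).le, rfl⟩, rfl⟩) ?_
    rw [queueReact_encode δ hA]
    rcases hδ : δ q a with _ | ⟨q', v⟩
    · dsimp only
      rw [corec_queueNode_some, ← emits_append]
      exact conv_drain δ n fun x hx => by
        obtain ⟨b, -, rfl⟩ := List.mem_map.1 hx
        exact hA b
    · dsimp only
      rw [corec_queueNode_some, ← emits_append, ← List.map_append]
      exact ih (q', w ++ v) (by simp [queueStep, hδ])

/-- The invariant has two phases: between rounds, and after the output of a letter `a` not yet read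
back, when the configuration still counts `a` as the head of its queue. -/
theorem not_conv_of_not_halts (hA : ∀ a : A, Encodable.encode a < n) (hn : 0 < n) {c : Q × List A}
    (h : ¬ (eval (queueStep δ) c).Dom) :
    ¬ Conv (emits (c.2.map Encodable.encode) (queueTree δ n (some c.1))) (echoTree n) := by
  refine not_conv_of_invariant (P := fun S T =>
    ∃ q w, S = emits (w.map Encodable.encode) (queueTree δ n (some q)) ∧
      (¬ (eval (queueStep δ) (q, w)).Dom ∧ T = echoTree n ∨
        ∃ a, ¬ (eval (queueStep δ) (q, a :: w)).Dom ∧ T = echoInp n (Encodable.encode a)))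
    ?_ ?_ ?_ ⟨c.1, c.2, rfl, Or.inl ⟨h, rfl⟩⟩
  · rintro S T α S' T' ⟨q, w, rfl, ⟨hq, rfl⟩ | ⟨a, hq, rfl⟩⟩ hS hT
    · cases α with
      | inp x => exact absurd hT (not_step_echoTree_inp n hn)
      | out x =>
        obtain ⟨-, rfl⟩ := (step_echoTree_out n).1 hT
        cases w with
        | nil => exact absurd hS (not_step_queueTree_out δ n)
        | cons a w =>
          obtain ⟨rfl, rfl⟩ := step_emit_out_iff.1 hS
          exact ⟨q, w, rfl, Or.inr ⟨a, hq, rfl⟩⟩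
    · obtain ⟨rfl, rfl⟩ := (step_echoInp_iff n).1 hT
      rw [if_neg (hA a).ne]
      obtain ⟨S₁, hS₁, rfl⟩ := step_emits_inp_iff.1 hS
      obtain ⟨-, rfl⟩ := (step_queueTree_iff δ n).1 hS₁
      rw [queueReact_encode δ hA]
      rcases hδ : δ q a with _ | ⟨q', v⟩
      · refine absurd (Part.dom_iff_mem.2 ⟨_, mem_eval.2 ⟨Relation.ReflTransGen.refl, ?_⟩⟩) hq
        simp [queueStep, hδ]
      · refine ⟨q', w ++ v, ?_, Or.inl ⟨?_, rfl⟩⟩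
        · rw [List.map_append, emits_append, ← corec_queueNode_some]
        · rwa [reaches_eval (b := (q', w ++ v))
            (Relation.ReflTransGen.single (by simp [queueStep, hδ]))] at hq
  · rintro T ⟨q, _ | ⟨a, w⟩, hS, -⟩
    · rw [List.map_nil, emits_nil, queueTree_eq] at hS
      exact inp_ne_done _ _ hS.symm
    · exact emit_ne_done _ _ hS.symm
  · rintro S T ⟨q, w, -, ⟨-, rfl⟩ | ⟨a, -, rfl⟩⟩
    · exact ⟨_, traces_echoTree_end n⟩
    · exact ⟨_, .cons ((step_echoInp_iff n).2 ⟨rfl, (if_neg (hA a).ne).symm⟩)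
        (traces_echoTree_end n)⟩

/-- The session type of a queue machine converges to the echoing type if and only if the machine
halts. -/
theorem conv_iff_halts (hA : ∀ a : A, Encodable.encode a < n) (hn : 0 < n) {q : Q} {w : List A} :
    Conv (emits (w.map Encodable.encode) (queueTree δ n (some q))) (echoTree n) ↔
      (eval (queueStep δ) (q, w)).Dom :=
  ⟨fun h => by_contra fun h' => not_conv_of_not_halts δ hA hn h' h, fun h => conv_of_halts δ hA h⟩

end QueueMachine

/-! ### Simulating stacks by a queue -/

section StackMachine

variable {Q K Γ : Type}

/-- The queue that holds the stacks with indices in the list. -/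
def stackBlocks (S : K → List Γ) (ks : List K) : List (K ⊕ Γ) :=
  ks.flatMap fun k => Sum.inl k :: (S k).map Sum.inr

theorem stackBlocks_append (S : K → List Γ) (ks ls : List K) :
    stackBlocks S (ks ++ ls) = stackBlocks S ks ++ stackBlocks S ls := by
  simp [stackBlocks]

theorem stackBlocks_cons (S : K → List Γ) (k : K) (ks : List K) :
    stackBlocks S (k :: ks) = Sum.inl k :: ((S k).map Sum.inr ++ stackBlocks S ks) := by
  simp [stackBlocks]

variable [DecidableEq K]

/-- A step of the machine with stacks indexed by `K` and with program `prog`: if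
`prog q = (k, F)`, the top `t` of the stack `k` (or `none`, if it is empty) is replaced by the
word `v` and the state by `q'`, where `F t = (v, q')`. -/
def stackStep (prog : Q → Option (K × (Option Γ → List Γ × Q))) :
    Q × (K → List Γ) → Option (Q × (K → List Γ)) := fun c =>
  (prog c.1).map fun p => ((p.2 (c.2 p.1).head?).2,
    Function.update c.2 p.1 ((p.2 (c.2 p.1).head?).1 ++ (c.2 p.1).tail))

variable (prog : Q → Option (K × (Option Γ → List Γ × Q)))

/-- The queue machine that simulates a machine with stacks. The queue holds the stacks, each
preceded by its index. A state `(q, false)` searches for the stack on which `q` operates, and a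
state `(q, true)` is about to read the top of this stack. -/
def stackQueue : Q × Bool → K ⊕ Γ → Option ((Q × Bool) × List (K ⊕ Γ))
  | (q, false), Sum.inr t => some ((q, false), [Sum.inr t])
  | (q, false), Sum.inl j => (prog q).map fun p => ((q, decide (j = p.1)), [Sum.inl j])
  | (q, true), Sum.inr t => (prog q).map fun p =>
      (((p.2 (some t)).2, false), (p.2 (some t)).1.map Sum.inr)
  | (q, true), Sum.inl j => (prog q).map fun p =>
      (((p.2 none).2, false), (p.2 none).1.map Sum.inr ++ [Sum.inl j])

theorem stackBlocks_update (S : K → List Γ) {k : K} {ks : List K} (h : k ∉ ks) (v : List Γ) :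
    stackBlocks (Function.update S k v) ks = stackBlocks S ks := by
  unfold stackBlocks
  refine List.flatMap_congr fun j hj => ?_
  rw [Function.update_of_ne (ne_of_mem_of_not_mem hj h)]

theorem reaches_copy (q : Q) (u : List Γ) (w : List (K ⊕ Γ)) :
    Reaches (queueStep (stackQueue prog)) ((q, false), u.map Sum.inr ++ w)
      ((q, false), w ++ u.map Sum.inr) := by
  induction u generalizing w with
  | nil => simpa [Reaches] using Relation.ReflTransGen.refl
  | cons t u ih =>
    refine Relation.ReflTransGen.head (b := ((q, false), u.map Sum.inr ++ (w ++ [Sum.inr t]))) ?_ ?_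
    · simp [queueStep, stackQueue]
    · have h := ih (w ++ [Sum.inr t])
      rw [List.append_assoc w] at h
      simpa [Reaches] using h

variable {prog}

theorem reaches_seek {q : Q} {k : K} {F : Option Γ → List Γ × Q} (hq : prog q = some (k, F))
    (S : K → List Γ) {ks : List K} (hk : k ∉ ks) (w : List (K ⊕ Γ)) :
    Reaches (queueStep (stackQueue prog)) ((q, false), stackBlocks S ks ++ w)
      ((q, false), w ++ stackBlocks S ks) := by
  induction ks generalizing w with
  | nil => simpa [Reaches, stackBlocks] using Relation.ReflTransGen.refl
  | cons j ks ih =>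
    obtain ⟨hj, hk⟩ := not_or.1 (mt List.mem_cons.2 hk)
    refine Relation.ReflTransGen.head
      (b := ((q, false), (S j).map Sum.inr ++ (stackBlocks S ks ++ (w ++ [Sum.inl j])))) ?_ ?_
    · simp [stackBlocks_cons, queueStep, stackQueue, hq, Ne.symm hj]
    · refine (reaches_copy prog q (S j) _).trans ?_
      simpa [Reaches, stackBlocks_cons] using ih hk (w ++ Sum.inl j :: (S j).map Sum.inr)

/-- Rotation permutes the blocks, so their order `ks` may change with each step. -/
theorem reaches_stackStep [Nontrivial K] {q : Q} {k : K} {F : Option Γ → List Γ × Q}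
    (hq : prog q = some (k, F)) (S : K → List Γ) {ks : List K} (hn : ks.Nodup)
    (hks : ∀ j, j ∈ ks) : ∃ ls : List K, (ls.Nodup ∧ ∀ j, j ∈ ls) ∧
      Reaches₁ (queueStep (stackQueue prog)) ((q, false), stackBlocks S ks)
        (((F (S k).head?).2, false),
          stackBlocks (Function.update S k ((F (S k).head?).1 ++ (S k).tail)) ls) := by
  obtain ⟨u, v, rfl⟩ := List.append_of_mem (hks k)
  have hperm : List.Perm (u ++ k :: v) ((v ++ u) ++ [k]) :=
    List.perm_append_comm.trans (by simpa using List.perm_append_comm (l₁ := [k]) (l₂ := v ++ u))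
  have hn' := hperm.nodup_iff.1 hn
  have hks' : ∀ j, j ∈ (v ++ u) ++ [k] := fun j => hperm.mem_iff.1 (hks j)
  have hk : k ∉ v ++ u := fun h =>
    (List.nodup_append.1 hn').2.2 k h k (List.mem_singleton_self k) rfl
  have h₁ : Reaches₁ (queueStep (stackQueue prog)) ((q, false), stackBlocks S (u ++ k :: v))
      ((q, true), (S k).map Sum.inr ++ (stackBlocks S (v ++ u) ++ [Sum.inl k])) := by
    rw [stackBlocks_append]
    refine Relation.TransGen.tail'
      (reaches_seek hq S (fun h => hk (List.mem_append_right _ h)) _) ?_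
    simp [stackBlocks_cons, stackBlocks_append, queueStep, stackQueue, hq]
  rcases hS : S k with _ | ⟨t, r⟩
  -- On an empty stack the symbol read is the marker `j` of the next block. A second stack ensures
  -- that `j ≠ k`; the new word is written behind the marker `k`, then `j` is restored and its block
  -- copied after it.
  · obtain ⟨j, ls, hls⟩ : ∃ j ls, v ++ u = j :: ls := by
      rcases h : v ++ u with _ | ⟨j, ls⟩
      · obtain ⟨j, hj⟩ := exists_ne k
        have := hks' j
        rw [h] at this
        exact absurd (List.mem_singleton.1 this) hj
      · exact ⟨j, ls, rfl⟩
    rw [hls] at hn' hks' hk h₁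
    obtain ⟨hkj, hkl⟩ := not_or.1 (mt List.mem_cons.2 hk)
    have hperm : List.Perm ((j :: ls) ++ [k]) (ls ++ [k, j]) := by
      simpa using (List.perm_append_comm (l₁ := [j]) (l₂ := ls ++ [k]))
    refine ⟨ls ++ [k, j], ⟨hperm.nodup_iff.1 hn', fun i => hperm.mem_iff.1 (hks' i)⟩,
      h₁.trans_left (Relation.ReflTransGen.head (b := (((F none).2, false), (S j).map Sum.inr ++
        (stackBlocks S ls ++ Sum.inl k :: ((F none).1.map Sum.inr ++ [Sum.inl j])))) ?_ ?_)⟩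
    · simp [hS, stackBlocks_cons, queueStep, stackQueue, hq]
    · have h := reaches_copy prog (F none).2 (S j)
        (stackBlocks S ls ++ Sum.inl k :: ((F none).1.map Sum.inr ++ [Sum.inl j]))
      simp only [stackBlocks_append, stackBlocks_update S hkl, stackBlocks_cons,
        Function.update_self, Function.update_of_ne (Ne.symm hkj)]
      simpa [Reaches, stackBlocks] using h
  -- The new word goes behind the marker `k`; rotating the rest `r` of the stack places it below
  -- that word.
  · refine ⟨(v ++ u) ++ [k], ⟨hn', hks'⟩, h₁.trans_left (Relation.ReflTransGen.head
      (b := (((F (some t)).2, false), r.map Sum.inr ++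
        (stackBlocks S (v ++ u) ++ Sum.inl k :: (F (some t)).1.map Sum.inr))) ?_ ?_)⟩
    · simp [hS, queueStep, stackQueue, hq]
    · have h := reaches_copy prog (F (some t)).2 r
        (stackBlocks S (v ++ u) ++ Sum.inl k :: (F (some t)).1.map Sum.inr)
      rw [stackBlocks_append _ (v ++ u), stackBlocks_update S hk, stackBlocks_cons,
        Function.update_self]
      simpa [Reaches, stackBlocks] using h

/-- A machine with at least two stacks halts if and only if the queue machine that simulates it
does. -/
theorem stackQueue_halts_iff [Nontrivial K] {q : Q} {S : K → List Γ} {ks : List K}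
    (hn : ks.Nodup) (hks : ∀ j, j ∈ ks) :
    (eval (queueStep (stackQueue prog)) ((q, false), stackBlocks S ks)).Dom ↔
      (eval (stackStep prog) (q, S)).Dom := by
  refine tr_eval_dom (tr := fun c d => ∃ ks : List K, (ks.Nodup ∧ ∀ j, j ∈ ks) ∧
    d = ((c.1, false), stackBlocks c.2 ks)) ?_ ⟨ks, ⟨hn, hks⟩, rfl⟩
  rintro ⟨q, S⟩ _ ⟨ks, ⟨hn, hks⟩, rfl⟩
  rcases hq : prog q with _ | ⟨k, F⟩
  · simp only [stackStep, hq, Option.map_none]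
    -- The queue starts with a marker, on which a searching state without program halts.
    rcases ks with _ | ⟨j, ks⟩
    · exact absurd (hks (Classical.arbitrary K)) List.not_mem_nil
    · simp [stackBlocks_cons, queueStep, stackQueue, hq]
  · simp only [stackStep, hq, Option.map_some]
    obtain ⟨ls, hls, h⟩ := reaches_stackStep hq S hn hks
    exact ⟨_, ⟨ls, hls, rfl⟩, h⟩

theorem stackQueue_mem {s : Set Q} {L : ℕ}
    (hs : ∀ q ∈ s, ∀ p, prog q = some p → ∀ t, (p.2 t).2 ∈ s ∧ (p.2 t).1.length ≤ L)
    {q : Q × Bool} (hq : q ∈ s ×ˢ Set.univ) {a : K ⊕ Γ} {q' : Q × Bool} {v : List (K ⊕ Γ)}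
    (h : stackQueue prog q a = some (q', v)) : q' ∈ s ×ˢ Set.univ ∧ v.length ≤ L + 1 := by
  obtain ⟨q, b⟩ := q
  replace hq : q ∈ s := hq.1
  rcases b with _ | _ <;> rcases a with j | t
  · obtain ⟨p, hp, h⟩ := Option.map_eq_some_iff.1 h
    cases h
    exact ⟨⟨hq, trivial⟩, by simp⟩
  · cases h
    exact ⟨⟨hq, trivial⟩, by simp⟩
  · obtain ⟨p, hp, h⟩ := Option.map_eq_some_iff.1 h
    cases h
    exact ⟨⟨(hs q hq p hp none).1, trivial⟩, by simpa using (hs q hq p hp none).2⟩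
  · obtain ⟨p, hp, h⟩ := Option.map_eq_some_iff.1 h
    cases h
    exact ⟨⟨(hs q hq p hp (some t)).1, trivial⟩,
      by simpa using Nat.le_succ_of_le (hs q hq p hp (some t)).2⟩

end StackMachine

open Turing

/-! ### From `TM2` machines to stack programs -/

section TM2

variable {K Γ Λ σ : Type}

/-- The program that performs the statements of a `TM2` machine one by one. A state holds a label or
a statement, or neither if the machine has halted, and the content of the internal memory; `k₀` is
a dummy stack for the statements that do not use any stack. -/
def tm2Prog (M : Λ → TM2.Stmt (fun _ : K => Γ) Λ σ) (k₀ : K) :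
    Option (Λ ⊕ TM2.Stmt (fun _ : K => Γ) Λ σ) × σ →
      Option (K × (Option Γ → List Γ × (Option (Λ ⊕ TM2.Stmt (fun _ : K => Γ) Λ σ) × σ)))
  | (none, _) => none
  | (some (.inl l), v) => some (k₀, fun t => (t.toList, some (.inr (M l)), v))
  | (some (.inr (.push k f q)), v) => some (k, fun t => (f v :: t.toList, some (.inr q), v))
  | (some (.inr (.peek k f q)), v) => some (k, fun t => (t.toList, some (.inr q), f v t))
  | (some (.inr (.pop k f q)), v) => some (k, fun t => ([], some (.inr q), f v t))
  | (some (.inr (.load a q)), v) => some (k₀, fun t => (t.toList, some (.inr q), a v))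
  | (some (.inr (.branch f q₁ q₂)), v) =>
      some (k₀, fun t => (t.toList, some (.inr (cond (f v) q₁ q₂)), v))
  | (some (.inr (.goto f)), v) => some (k₀, fun t => (t.toList, some (.inl (f v)), v))
  | (some (.inr .halt), v) => some (k₀, fun t => (t.toList, none, v))

variable {M : Λ → TM2.Stmt (fun _ : K => Γ) Λ σ} {k₀ : K}

/-- Labels may be infinitely many, but only supported labels and their substatements occur. The
bound `2` comes from `push`, which writes back the old top with a new symbol. -/
theorem tm2Prog_finite [Finite σ] {s : Finset Λ} (hs : ∀ l ∈ s, TM2.SupportsStmt s (M l)) :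
    ∃ t : Set (Option (Λ ⊕ TM2.Stmt (fun _ : K => Γ) Λ σ) × σ), t.Finite ∧
      (∀ l ∈ s, ∀ v, (some (.inl l), v) ∈ t) ∧
      ∀ q ∈ t, ∀ p, tm2Prog M k₀ q = some p → ∀ a, (p.2 a).2 ∈ t ∧ (p.2 a).1.length ≤ 2 := by
  classical
  let X : Set (TM2.Stmt (fun _ : K => Γ) Λ σ) := ↑(s.biUnion fun l => TM2.stmts₁ (M l))
  have hX : ∀ q, q ∈ X ↔ ∃ l ∈ s, q ∈ TM2.stmts₁ (M l) := fun q => by simp [X]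
  have hsub : ∀ q ∈ X, ∀ q', q' ∈ TM2.stmts₁ q → q' ∈ X := fun q hq q' h => by
    obtain ⟨l, hl, hq⟩ := (hX q).1 hq
    exact (hX q').2 ⟨l, hl, TM2.stmts₁_trans hq h⟩
  let Y : Set (Option (Λ ⊕ TM2.Stmt (fun _ : K => Γ) Λ σ)) :=
    insert none (some '' (Sum.inl '' (s : Set Λ) ∪ Sum.inr '' X))
  have hY : Y.Finite :=
    ((((Finset.finite_toSet s).image _).union ((Finset.finite_toSet _).image _)).image _).insert _
  have hYl : ∀ l, some (Sum.inl l) ∈ Y ↔ l ∈ s := fun l => by simp [Y]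
  have hYq : ∀ q, some (Sum.inr q) ∈ Y ↔ q ∈ X := fun q => by simp [Y]
  have hlen : ∀ a : Option Γ, a.toList.length ≤ 1 := fun a => by cases a <;> simp
  have hlen₂ : ∀ a : Option Γ, a.toList.length ≤ 2 := fun a => (hlen a).trans one_le_two
  refine ⟨Y ×ˢ Set.univ, hY.prod Set.finite_univ, fun l hl v => ⟨(hYl l).2 hl, trivial⟩, ?_⟩
  rintro ⟨_ | l | q, v⟩ ⟨hq, -⟩ p hp a
  · cases hp
  · cases hp
    exact ⟨⟨(hYq _).2 ((hX _).2 ⟨l, (hYl l).1 hq, TM2.stmts₁_self⟩), trivial⟩, hlen₂ a⟩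
  · replace hq := (hYq q).1 hq
    cases q with
    | push k f q =>
      cases hp
      refine ⟨⟨(hYq _).2 (hsub _ hq _ ?_), trivial⟩, Nat.succ_le_succ (hlen a)⟩
      simp [TM2.stmts₁, TM2.stmts₁_self]
    | peek k f q =>
      cases hp
      refine ⟨⟨(hYq _).2 (hsub _ hq _ ?_), trivial⟩, hlen₂ a⟩
      simp [TM2.stmts₁, TM2.stmts₁_self]
    | pop k f q =>
      cases hp
      refine ⟨⟨(hYq _).2 (hsub _ hq _ ?_), trivial⟩, Nat.zero_le _⟩
      simp [TM2.stmts₁, TM2.stmts₁_self]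
    | load f q =>
      cases hp
      refine ⟨⟨(hYq _).2 (hsub _ hq _ ?_), trivial⟩, hlen₂ a⟩
      simp [TM2.stmts₁, TM2.stmts₁_self]
    | branch f q₁ q₂ =>
      cases hp
      refine ⟨⟨(hYq _).2 (hsub _ hq _ ?_), trivial⟩, hlen₂ a⟩
      cases f v <;> simp [TM2.stmts₁, TM2.stmts₁_self]
    | goto f =>
      cases hp
      obtain ⟨l, hl, hq⟩ := (hX _).1 hq
      exact ⟨⟨(hYl _).2 (TM2.stmts₁_supportsStmt_mono hq (hs l hl) v), trivial⟩, hlen₂ a⟩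
    | halt =>
      cases hp
      exact ⟨⟨Set.mem_insert _ _, trivial⟩, hlen₂ a⟩

theorem toList_head?_append_tail {α : Type} (l : List α) : l.head?.toList ++ l.tail = l := by
  cases l <;> rfl

variable [DecidableEq K]

theorem reaches_stepAux (q : TM2.Stmt (fun _ : K => Γ) Λ σ) (v : σ) (S : K → List Γ) :
    Reaches (stackStep (tm2Prog M k₀)) ((some (.inr q), v), S)
      (((TM2.stepAux q v S).l.map .inl, (TM2.stepAux q v S).var), (TM2.stepAux q v S).stk) := by
  induction q generalizing v S with
  | push k f q ih =>
    refine Relation.ReflTransGen.head ?_ (ih _ _)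
    simp [stackStep, tm2Prog, toList_head?_append_tail]
  | peek k f q ih =>
    refine Relation.ReflTransGen.head ?_ (ih _ _)
    simp [stackStep, tm2Prog, toList_head?_append_tail]
  | pop k f q ih =>
    refine Relation.ReflTransGen.head ?_ (ih _ _)
    simp [stackStep, tm2Prog]
  | load a q ih =>
    refine Relation.ReflTransGen.head ?_ (ih _ _)
    simp [stackStep, tm2Prog, toList_head?_append_tail]
  | branch f q₁ q₂ ih₁ ih₂ =>
    rw [TM2.stepAux]
    rcases h : f v with _ | _
    · refine Relation.ReflTransGen.head ?_ (ih₂ v S)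
      simp [stackStep, tm2Prog, toList_head?_append_tail, h]
    · refine Relation.ReflTransGen.head ?_ (ih₁ v S)
      simp [stackStep, tm2Prog, toList_head?_append_tail, h]
  | goto f =>
    refine Relation.ReflTransGen.single ?_
    simp [stackStep, tm2Prog, toList_head?_append_tail]
  | halt =>
    refine Relation.ReflTransGen.single ?_
    simp [stackStep, tm2Prog, toList_head?_append_tail]

theorem tm2Prog_halts_iff (c : TM2.Cfg (fun _ : K => Γ) Λ σ) :
    (eval (stackStep (tm2Prog M k₀)) ((c.l.map .inl, c.var), c.stk)).Dom ↔
      (eval (TM2.step M) c).Dom := by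
  refine tr_eval_dom (tr := fun c d => ((c.l.map .inl, c.var), c.stk) = d) (fun_respects.2 ?_) rfl
  rintro ⟨_ | l, v, S⟩
  · simp [TM2.step, FRespects, stackStep, tm2Prog]
  · refine Relation.TransGen.head' ?_ (reaches_stepAux (M := M) (k₀ := k₀) (M l) v S)
    simp [stackStep, tm2Prog, toList_head?_append_tail]

end TM2

open Turing.PartrecToTM2

/-! ### The computable reduction -/

section Reduction

/-- The system that represents `!a₁.⋯.!aₙ.S`, if `c` represents `S`. -/
def Code.emits (w : List ℕ) (c : Code) : Code := w.foldr Code.emit c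

theorem Code.valid_emits_and_tree (w : List ℕ) {c : Code} (hc : c.Valid) :
    (c.emits w).Valid ∧ (c.emits w).tree = STree.emits w c.tree := by
  induction w with
  | nil => exact ⟨hc, rfl⟩
  | cons a w ih =>
    refine ⟨ih.1.emit a, (Code.tree_emit a ih.1).trans ?_⟩
    rw [ih.2]
    rfl

theorem primrec_emits (c : Code) : Primrec fun w : List ℕ => Code.emits w c := by
  refine Primrec.list_foldr .id (.const c) (h := fun _ p => Code.emit p.1 p.2) ?_
  have ha : Primrec fun p : List ℕ × ℕ × Code => p.2.1 := Primrec.fst.comp .snd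
  have hr : Primrec fun p : List ℕ × ℕ × Code => p.2.2.1 :=
    Primrec.fst.comp (Primrec.snd.comp .snd)
  have hl : Primrec fun p : List ℕ × ℕ × Code => p.2.2.2 :=
    Primrec.snd.comp (Primrec.snd.comp .snd)
  exact Primrec.pair (Primrec.list_length.comp hl) <| Primrec.list_concat.comp hl <|
    Primrec.option_some.comp <| Primrec.pair (.const true) <|
      Primrec.list_cons.comp (Primrec.pair ha hr) (.const [])

/-- The number whose binary representation consists of `m` ones. -/
def ones (m : ℕ) : ℕ := (fun x => 2 * x + 1)^[m] 0

theorem ones_succ (m : ℕ) : ones (m + 1) = 2 * ones m + 1 :=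
  Function.iterate_succ_apply' _ _ _

theorem ones_strictMono : StrictMono ones := strictMono_nat_of_lt_succ fun m => by
  rw [ones_succ]
  omega

theorem primrec_ones : Primrec ones :=
  Primrec.nat_iterate .id (.const 0) (h := fun _ x => 2 * x + 1) <|
    Primrec.succ.comp <| Primrec.nat_mul.comp (.const 2) .snd

theorem trNat_ones (m : ℕ) : trNat (ones m) = List.replicate m Γ'.bit1 := by
  induction m with
  | zero => exact trNat_zero
  | succ m ih =>
    have h : ((ones (m + 1) : ℕ) : Num) = (ones m : Num).bit1 := by
      rw [ones_succ, ← Num.bit1_of_bit1]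
      push_cast
      rw [two_mul]
    rw [List.replicate_succ, ← ih, trNat, trNat, h]
    cases (ones m : Num) <;> rfl

/-- A universal function `g` decodes `ones m` by search and runs program `m` on `0`. Inputs of this
form suffice for undecidability, and their binary digits are `m` equal symbols. -/
theorem exists_toPartrec_undecidable : ∃ c : ToPartrec.Code,
    ¬ ∃ f : ℕ → Bool, Computable f ∧ ∀ m, f m = true ↔ (c.eval [ones m]).Dom := by
  let g : ℕ →. ℕ := fun x => (Nat.rfind fun m => Part.some (decide (ones m = x))).bind fun m =>
    (Denumerable.ofNat Nat.Partrec.Code m).eval 0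
  have hg : Partrec g := by
    refine Partrec.bind (Partrec.rfind ?_) ?_
    · have h : PrimrecPred fun p : ℕ × ℕ => ones p.2 = p.1 :=
        Primrec.eq.comp (primrec_ones.comp .snd) .fst
      exact h.decide.to_comp.partrec
    · exact Nat.Partrec.Code.eval_part.comp ((Computable.ofNat _).comp .snd) (.const 0)
  have hdom : ∀ m, (g (ones m)).Dom ↔ ((Denumerable.ofNat Nat.Partrec.Code m).eval 0).Dom := by
    intro m
    have h : Nat.rfind (fun k => Part.some (decide (ones k = ones m))) = Part.some m := by
      refine Part.eq_some_iff.2 (Nat.mem_rfind.2 ⟨by simp, fun {k} hk => ?_⟩)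
      simpa using (ones_strictMono hk).ne
    simp only [g, h, Part.bind_some]
  obtain ⟨c, hc⟩ := ToPartrec.Code.exists_code (Nat.Partrec'.part_iff₁.2 hg)
  have hceval : ∀ m, (c.eval [ones m]).Dom ↔
      ((Denumerable.ofNat Nat.Partrec.Code m).eval 0).Dom := by
    intro m
    rw [← hdom, show [ones m] = (ones m ::ᵥ List.Vector.nil).1 from rfl, hc]
    rfl
  refine ⟨c, fun ⟨f, hf, hfc⟩ => ComputablePred.halting_problem 0 ?_⟩
  refine ComputablePred.computable_iff.2
    ⟨fun d => f (Encodable.encode d), hf.comp .encode, funext fun d => propext ?_⟩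
  rw [hfc, hceval, Denumerable.ofNat_encode]

instance : Finite K' :=
  Set.finite_univ_iff.1 <| (Set.toFinite {K'.main, K'.rev, K'.aux, K'.stack}).subset fun k _ => by
    cases k <;> simp

instance : Nontrivial K' := ⟨K'.main, K'.rev, by decide⟩

theorem exists_reduction (c : ToPartrec.Code) : ∃ (F : ℕ → Code) (d : Code), Computable F ∧
    d.Valid ∧ ∀ m, (F m).Valid ∧ (Conv (F m).tree d.tree ↔ (c.eval [ones m]).Dom) := by
  classical
  have : Encodable (K' ⊕ Γ') := @Fintype.toEncodable _ (Fintype.ofFinite _)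
  -- The number `b + 1` exceeds all letter codes and serves as the end marker.
  obtain ⟨b, hb⟩ := (Set.finite_range (Encodable.encode : K' ⊕ Γ' → ℕ)).bddAbove
  have hA : ∀ a : K' ⊕ Γ', Encodable.encode a < b + 1 := fun a =>
    Nat.lt_succ_of_le (hb (Set.mem_range_self a))
  let δ := stackQueue (tm2Prog (Γ := Γ') (σ := Option Γ') tr K'.main)
  let q₀ : (Option (Λ' ⊕ TM2.Stmt (fun _ : K' => Γ') Λ' (Option Γ')) × Option Γ') × Bool :=
    ((some (.inl (trNormal c Cont'.halt)), none), false)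
  obtain ⟨t, ht, hl, hp⟩ := tm2Prog_finite (M := tr) (k₀ := K'.main) (tr_supports c Cont'.halt).2
  obtain ⟨c₀, hc₀, hc₀t⟩ := exists_code_queueTree δ (b + 1) hA (ht.prod Set.finite_univ)
    (fun q hq a q' v h => stackQueue_mem hp hq h) (q := q₀)
    ⟨hl _ (tr_supports c Cont'.halt).1 none, trivial⟩
  obtain ⟨d, hd, hdt⟩ := exists_code_echoTree (b + 1)
  let W : ℕ → List (K' ⊕ Γ') := fun m =>
    stackBlocks (K'.elim (trList [ones m]) [] [] []) [K'.main, K'.rev, K'.aux, K'.stack]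
  have hW : Primrec fun m => (W m).map Encodable.encode := by
    -- By `trNat_ones` the initial queue is `m` copies of one letter in a constant frame.
    refine Primrec.of_eq (f := fun m => Encodable.encode (Sum.inl K'.main : K' ⊕ Γ') ::
      ((List.range m).map (fun _ => Encodable.encode (Sum.inr Γ'.bit1 : K' ⊕ Γ')) ++
        [Sum.inr Γ'.cons, Sum.inl K'.rev, Sum.inl K'.aux, Sum.inl K'.stack].map
          (Encodable.encode : K' ⊕ Γ' → ℕ))) ?_ fun m => ?_
    · exact Primrec.list_cons.comp (.const _) <| Primrec.list_append.comp
        (Primrec.list_map Primrec.list_range (Primrec.const _).to₂) (.const _)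
    · simp [W, stackBlocks, trNat_ones]
  refine ⟨fun m => c₀.emits ((W m).map Encodable.encode), d,
    ((primrec_emits c₀).comp hW).to_comp, hd, fun m => ?_⟩
  obtain ⟨h₁, h₂⟩ := Code.valid_emits_and_tree ((W m).map Encodable.encode) hc₀
  refine ⟨h₁, ?_⟩
  rw [h₂, hc₀t, hdt, conv_iff_halts δ hA b.succ_pos]
  refine (stackQueue_halts_iff (by decide) fun k => by cases k <;> simp).trans ?_
  refine (tm2Prog_halts_iff (init c [ones m])).trans ?_
  rw [PartrecToTM2.tr_eval]
  rfl

end Reduction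

end FairSession

theorem mainTheorem5 :
    ¬ ∃ f : FairSession.Code × FairSession.Code → Bool, Computable f ∧
      ∀ c d : FairSession.Code, c.Valid → d.Valid →
        (f (c, d) = true ↔ FairSession.Conv c.tree d.tree) := by
  rintro ⟨f, hf, hfc⟩
  obtain ⟨c, hc⟩ := FairSession.exists_toPartrec_undecidable
  obtain ⟨F, d, hF, hd, h⟩ := FairSession.exists_reduction c
  exact hc ⟨fun m => f (F m, d), hf.comp (hF.pair (.const d)), fun m =>
    (hfc _ _ (h m).1 hd).trans (h m).2⟩
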